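/- All logarithms are to base $2$, and all constants implied by $\ll$ are absolute unless a dependence is indicated. For a prime $p$ write $\mathbb F_p^*=\mathbb F_p\setminus\{0\}$. (1) Let $p$ be a prime and let $A,\Gamma\subseteq\mathbb F_p^*$ be multiplicative subgroups with $2\le |A|<\sqrt p$ and $|\Gamma|<p^{3/4}$. Let $s\in\mathbb F_p$, $\xi\in\mathbb F_p^*$, and let $A'\subseteq A+s$ satisfy $A'-A'\subseteq \xi\Gamma\sqcup\{0\}$. Then $$|A'|^6\ll |A|^4\,|\Gamma|^{2/3}\log|A|.$$ (2) Let $p$ be a prime and let $A,\Gamma\subseteq\mathbb F_p^*$ be multiplicative subgroups with $2\le|\Gamma|<p^{3/4}$ such that $A-A\subseteq\xi\Gamma\sqcup\{0\}$ for some $\xi\in\mathbb F_p^*$. Then $$|A|\ll|\Gamma|^{1/3}\log^{1/2}|\Gamma|.$$ (3) Consequently, if $A,\Gamma\subseteq\mathbb F_p^*$ are multiplicative subgroups with $|\Gamma|<p^{3/4}$ and $A-A\subseteq\xi\Gamma\sqcup\{0\}$ for some $\xi\in\mathbb F_p^*$, then $|A|\ll|\Gamma|^{1/3+o(1)}$;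 that is, for every $\varepsilon>0$ one has $|A|\ll_{\varepsilon}|\Gamma|^{1/3+\varepsilon}$. -/

import Mathlib

open scoped Pointwise

/-- The elements of a subgroup of `F_p^*`, as a subset of `F_p`. -/
def subgroupSet {p : ℕ} (A : Subgroup (ZMod p)ˣ) : Set (ZMod p) :=
  {x | ∃ a ∈ A, x = (a : ZMod p)}

/-- The shift `A + s` of a subgroup `A` of `F_p^*`, as a subset of `F_p`. -/
def subgroupShift {p : ℕ} (A : Subgroup (ZMod p)ˣ) (s : ZMod p) : Set (ZMod p) :=
  {x | ∃ a ∈ A, x = (a : ZMod p) + s}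

/-- The set `ξΓ ⊔ {0}`, for a subgroup `Γ` of `F_p^*` and `ξ ∈ F_p^*`. -/
def cosetWithZero {p : ℕ} (ξ : (ZMod p)ˣ) (Γ : Subgroup (ZMod p)ˣ) : Set (ZMod p) :=
  {x | ∃ γ ∈ Γ, x = (ξ : ZMod p) * (γ : ZMod p)} ∪ {0}

/-! Write `t = |A|`, `T = |Γ|`, translate `A'` into `A`, and set `v = (a-b)/(a-c)` for distinct `a,
b, c` in the translate. Then `1-v = (b-c)/(a-c)`, the factor `ξ` cancels, and both `v` and `1-v` are
`T`-th roots of unity; Stepanov's method leaves `O(T^{2/3})` such `v` (`card_unitPairs_le_rpow`).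

Conversely, put `u = 1/(1-v)` and `x = u·b/a`. Then `1-x = (1-u)·c/a`, so `x` lies in the class of
`u`: the points sharing its values of `x^t` and `(1-x)^t`. A ratio `v` thus comes from at most
`t·|class(u)|` triples (`card_fiber_tripleRatio_le`). Stepanov's method over many pairs of values
shows that `O(t²/τ²)` points have a class of size at least `τ` (`card_powerLevel_le`), and summing
over `τ` gives `∑ |class(u)|² ≪ t² log t`. Cauchy–Schwarz over `v` then yields `|A'|^6 ≪ T^{2/3} ·
t² · t² log t`.

For (2), `|A| ≤ |V| + 2`, with `V` the set of admissible `v`, already gives `|A|² ≪ p`. The bound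
above is therefore proved under `t² ≤ L p` instead of `t < √p`, and is applied with `A' = A`. Part
(3) absorbs the logarithm into a power. -/

open Polynomial in
/-- The operator `R ↦ X(1-X)R' + (b(1-X) - cX)R`, which describes the action of `X(1-X) d/dX`
on `R X^b (1-X)^c`. -/
noncomputable def twistedDeriv {K : Type*} [Field K] (b c : K) : Module.End K K[X] :=
  LinearMap.mulLeft K (X * (1 - X)) ∘ₗ derivative + LinearMap.mulLeft K (C b * (1 - X) - C c * X)

/-! ### Twisted derivations and order of vanishing. -/

namespace Stepanov

open Polynomial

variable {K : Type*} [Field K]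

theorem twistedDeriv_apply (b c : K) (R : K[X]) :
    twistedDeriv b c R = X * (1 - X) * derivative R + (C b * (1 - X) - C c * X) * R := rfl

theorem X_mul_derivative_X_pow (m : ℕ) :
    X * derivative (X ^ m : K[X]) = C (m : K) * X ^ m := by
  cases m with
  | zero => simp
  | succ m => simp; ring

theorem one_sub_X_mul_derivative_pow (n : ℕ) :
    (1 - X) * derivative ((1 - X) ^ n : K[X]) = - C (n : K) * (1 - X) ^ n := by
  cases n with
  | zero => simp
  | succ n => simp [derivative_pow]; ring

/-- Conjugation by `X^m (1-X)^n` turns the derivation `X(1-X) d/dX` into a twisted one acting on `R`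
alone. High powers thus survive only as a factor, whose value at `x` depends on `x^t` and `(1-x)^t`
when `t` divides `m` and `n`. -/
theorem twistedDeriv_mul (m n : ℕ) (R : K[X]) :
    twistedDeriv 0 0 (R * (X ^ m * (1 - X) ^ n)) =
      twistedDeriv (m : K) (n : K) R * (X ^ m * (1 - X) ^ n) := by
  simp only [twistedDeriv_apply, derivative_mul, map_zero]
  linear_combination (R * (1 - X) * (1 - X) ^ n) * X_mul_derivative_X_pow (K := K) m +
    (R * X * X ^ m) * one_sub_X_mul_derivative_pow (K := K) n

theorem twistedDeriv_pow_mul (k m n : ℕ) (R : K[X]) :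
    (twistedDeriv (0 : K) 0 ^ k) (R * (X ^ m * (1 - X) ^ n)) =
      (twistedDeriv (m : K) (n : K) ^ k) R * (X ^ m * (1 - X) ^ n) := by
  induction k with
  | zero => simp
  | succ k ih => rw [pow_succ', Module.End.mul_apply, ih, twistedDeriv_mul, pow_succ',
      Module.End.mul_apply]

theorem twistedDeriv_mem_degreeLT (b c : K) {R : K[X]} {m : ℕ} (hR : R ∈ degreeLT K m) :
    twistedDeriv b c R ∈ degreeLT K (m + 1) := by
  rw [mem_degreeLT] at hR ⊢
  by_cases h0 : R = 0
  · simp [h0, twistedDeriv_apply]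
  have hn : R.natDegree < m := (natDegree_lt_iff_degree_lt h0).2 hR
  rw [twistedDeriv_apply]
  refine lt_of_le_of_lt degree_le_natDegree ?_
  norm_cast
  refine Nat.lt_succ_of_le ((natDegree_add_le _ _).trans (max_le ?_ ?_))
  · rcases Nat.eq_zero_or_pos R.natDegree with h | h
    · rw [eq_C_of_natDegree_eq_zero h]; simp
    · refine natDegree_mul_le.trans ?_
      have h1 : (X * (1 - X) : K[X]).natDegree ≤ 2 := by compute_degree
      have h2 := natDegree_derivative_lt h.ne'
      omega
  · refine natDegree_mul_le.trans ?_
    have h1 : (C b * (1 - X) - C c * X : K[X]).natDegree ≤ 1 := by compute_degree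
    omega

theorem twistedDeriv_pow_mem_degreeLT (b c : K) {R : K[X]} {m : ℕ} (hR : R ∈ degreeLT K m)
    (k : ℕ) : (twistedDeriv b c ^ k) R ∈ degreeLT K (m + k) := by
  induction k with
  | zero => simpa using hR
  | succ k ih =>
    rw [pow_succ', Module.End.mul_apply]
    exact twistedDeriv_mem_degreeLT b c ih

/-- With `F = (X-x)^m G`, the derivative forces `X-x` to divide `m G`; since `0 < m < p`, the factor
`m` is invertible. -/
theorem X_sub_C_pow_succ_dvd {p : ℕ} [CharP K p] {F : K[X]} {x : K} {m : ℕ} (hm : m < p)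
    (h0 : F.eval x = 0) (hF : (X - C x) ^ m ∣ F) (h1 : (X - C x) ^ m ∣ derivative F) :
    (X - C x) ^ (m + 1) ∣ F := by
  rcases Nat.eq_zero_or_pos m with rfl | hpos
  · simpa using dvd_iff_isRoot.2 h0
  obtain ⟨G, rfl⟩ := hF
  obtain ⟨m, rfl⟩ := Nat.exists_eq_add_of_lt hpos
  simp only [zero_add] at *
  rw [pow_succ]
  refine mul_dvd_mul_left _ ?_
  have h2 : (X - C x) ^ (m + 1) ∣ (X - C x) ^ m * (C ((m + 1 : ℕ) : K) * G) := by
    have := dvd_sub h1 (Dvd.intro (derivative G) rfl : (X - C x) ^ (m + 1) ∣ _)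
    convert this using 1
    simp [derivative_mul, derivative_X_sub_C_pow]
    ring
  rw [pow_succ, mul_dvd_mul_iff_left (pow_ne_zero _ (X_sub_C_ne_zero x))] at h2
  have hu : IsUnit (C ((m + 1 : ℕ) : K)) := by
    rw [isUnit_C, isUnit_iff_ne_zero, Ne, CharP.cast_eq_zero_iff K p]
    exact fun h => absurd (Nat.le_of_dvd (Nat.succ_pos m) h) (not_le.2 hm)
  exact (hu.dvd_mul_left).1 h2

/-- Away from `0` and `1` the factor `X(1-X)` is coprime to `X-x`, so iterates of `X(1-X) d/dX`
detect multiplicity as ordinary derivatives do, up to order `p`. -/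
theorem X_sub_C_pow_dvd_of_eval_eq_zero {p : ℕ} [CharP K p] {x : K} (hx0 : x ≠ 0) (hx1 : x ≠ 1)
    (m : ℕ) (hm : m ≤ p) (F : K[X])
    (h : ∀ k < m, ((twistedDeriv (0 : K) 0 ^ k) F).eval x = 0) : (X - C x) ^ m ∣ F := by
  induction m generalizing F with
  | zero => simp
  | succ m ih =>
    refine X_sub_C_pow_succ_dvd (p := p) hm (by simpa using h 0 (Nat.succ_pos m))
      (ih (by omega) F fun k hk => h k (by omega)) ?_
    have h1 : (X - C x) ^ m ∣ twistedDeriv (0 : K) 0 F := by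
      refine ih (by omega) _ fun k hk => ?_
      have := h (k + 1) (by omega)
      rwa [pow_succ, Module.End.mul_apply] at this
    rw [twistedDeriv_apply] at h1
    simp only [map_zero, zero_mul, sub_zero, add_zero] at h1
    refine IsCoprime.dvd_of_dvd_mul_left (IsCoprime.pow_left ?_) h1
    refine (irreducible_X_sub_C x).coprime_iff_not_dvd.2 fun hd => ?_
    rw [dvd_iff_isRoot, IsRoot] at hd
    simp only [eval_mul, eval_X, eval_sub, eval_one, mul_eq_zero, hx0, false_or, sub_eq_zero] at hd
    exact hx1 hd.symm

/-! ### Nonvanishing of the auxiliary polynomial. -/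

/-- A nonzero polynomial of degree less than the characteristic with at most `m` terms is not
divisible by `(X - 1) ^ m`. -/
theorem eq_zero_of_card_support_le {p : ℕ} [CharP K p] (m : ℕ) (H : K[X])
    (hdeg : ∀ n ∈ H.support, n < p) (hcard : H.support.card ≤ m) (hd : (X - C 1) ^ m ∣ H) :
    H = 0 := by
  induction m generalizing H with
  | zero => simpa using hcard
  | succ m ih =>
    by_contra hH
    obtain ⟨e, he⟩ := nonempty_support_iff.2 hH
    -- `X d/dX - e` deletes the term of exponent `e` and costs only one factor `X-1`.
    set G : K[X] := X * derivative H - C (e : K) * H with hG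
    have hcoeff : ∀ n, G.coeff n = ((n : K) - e) * H.coeff n := by
      intro n
      rw [hG, coeff_sub, coeff_C_mul]
      cases n with
      | zero => simp
      | succ n => rw [coeff_X_mul, coeff_derivative]; push_cast; ring
    have hsub : G.support ⊆ H.support.erase e := by
      intro n hn
      rw [mem_support_iff, hcoeff] at hn
      rw [Finset.mem_erase, mem_support_iff]
      exact ⟨fun h => hn (by simp [h]), right_ne_zero_of_mul hn⟩
    have hG0 : G = 0 := by
      refine ih G (fun n hn => hdeg n (Finset.mem_of_mem_erase (hsub hn))) ?_ ?_
      · have := Finset.card_le_card hsub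
        rw [Finset.card_erase_of_mem he] at this
        omega
      · refine dvd_sub (Dvd.dvd.mul_left ?_ _) (Dvd.dvd.mul_left ((pow_dvd_pow _ m.le_succ).trans hd) _)
        simpa using pow_sub_one_dvd_derivative_of_pow_dvd hd
    have honly : ∀ n ∈ H.support, n = e := by
      intro n hn
      have h1 := hcoeff n
      rw [hG0, coeff_zero] at h1
      have h2 : (n : K) = e :=
        sub_eq_zero.1 ((mul_eq_zero.1 h1.symm).resolve_right (mem_support_iff.1 hn))
      rw [CharP.natCast_eq_natCast K p] at h2
      exact Nat.ModEq.eq_of_lt_of_lt h2 (hdeg n hn) (hdeg e he)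
    have hroot : H.eval 1 = 0 := by
      have : (X - C 1) ∣ H := (dvd_pow_self _ (Nat.succ_ne_zero m)).trans hd
      exact dvd_iff_isRoot.1 this
    rw [eval_eq_sum, sum_def, Finset.sum_eq_single_of_mem e he
      (fun n hn hne => absurd (honly n hn) hne)] at hroot
    exact mem_support_iff.1 he (by simpa using hroot)

/-- As `m ≤ t`, the blocks of exponents `[tb, tb+m)` are disjoint, so no cancellation occurs between
different `b`. -/
theorem coeff_sum_mul_X_pow {t B m : ℕ} (hmt : m ≤ t) (R : Fin B → K[X])
    (hR : ∀ b, R b ∈ degreeLT K m) (a : ℕ) (ha : a < m) (b : Fin B) :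
    (∑ i, R i * X ^ (t * (i : ℕ))).coeff (a + t * b) = (R b).coeff a := by
  rw [finsetSum_coeff, Finset.sum_eq_single_of_mem b (Finset.mem_univ b)]
  · rw [coeff_mul_X_pow]
  · intro i _ hi
    rw [coeff_mul_X_pow']
    split_ifs with h
    · have hlt : (i : ℕ) < b := by
        by_contra hle
        have h1 : (b : ℕ) + 1 ≤ i := by
          have : (i : ℕ) ≠ b := fun h => hi (Fin.ext h)
          omega
        have := Nat.mul_le_mul_left t h1
        rw [mul_add] at this
        omega
      have h1 := Nat.mul_le_mul_left t (show (i : ℕ) + 1 ≤ b from hlt)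
      rw [mul_add] at h1
      refine coeff_eq_zero_of_degree_lt ((mem_degreeLT.1 (hR i)).trans_le ?_)
      norm_cast
      omega
    · rfl

/-- If the sum vanished, its lowest nonzero block `H c` would be divisible by `(1-X)^t`, while
having at most `mB ≤ t` terms and degree below `p`. -/
theorem sum_ne_zero {p : ℕ} [CharP K p] {t B m : ℕ} (hmt : m ≤ t) (hmB : m * B ≤ t)
    (htB : t * B ≤ p) (R : Fin B → Fin B → K[X]) (hR : ∀ b c, R b c ∈ degreeLT K m)
    (hne : ∃ b c, R b c ≠ 0) :
    ∑ c : Fin B, (∑ b : Fin B, R b c * X ^ (t * (b : ℕ))) * (1 - X) ^ (t * (c : ℕ)) ≠ 0 := by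
  classical
  intro hF
  set H : Fin B → K[X] := fun c => ∑ b : Fin B, R b c * X ^ (t * (b : ℕ)) with hH
  have hexc : (Finset.univ.filter fun c => H c ≠ 0).Nonempty := by
    obtain ⟨b, c, hbc⟩ := hne
    refine ⟨c, Finset.mem_filter.2 ⟨Finset.mem_univ _, fun h0 => hbc ?_⟩⟩
    ext a
    rcases lt_or_ge a m with ha | ha
    · rw [← coeff_sum_mul_X_pow hmt (fun b => R b c) (fun b => hR b c) a ha b]
      exact (congrArg (fun P => coeff P (a + t * b)) h0)
    · rw [coeff_zero]
      exact coeff_eq_zero_of_degree_lt ((mem_degreeLT.1 (hR b c)).trans_le (by exact_mod_cast ha))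
  obtain ⟨c, hc, hmin⟩ : ∃ c, H c ≠ 0 ∧ ∀ i, i < c → H i = 0 := by
    refine ⟨_, (Finset.mem_filter.1 (Finset.min'_mem _ hexc)).2, fun i hi => ?_⟩
    by_contra h
    exact absurd (Finset.min'_le _ i (Finset.mem_filter.2 ⟨Finset.mem_univ _, h⟩)) (not_le.2 hi)
  apply hc
  have hbound : ∀ b : Fin B, ∀ n ∈ (R b c * X ^ (t * (b : ℕ))).support,
      t * (b : ℕ) ≤ n ∧ n < m + t * b := by
    intro b n hn
    rw [mem_support_iff, coeff_mul_X_pow'] at hn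
    split_ifs at hn with h
    · refine ⟨h, ?_⟩
      by_contra hle
      refine hn (coeff_eq_zero_of_degree_lt ((mem_degreeLT.1 (hR b c)).trans_le ?_))
      norm_cast
      omega
    · exact absurd rfl hn
  have hsupp : (H c).support ⊆
      Finset.univ.biUnion fun b : Fin B => Finset.Ico (t * (b : ℕ)) (m + t * b) := by
    intro n hn
    rw [mem_support_iff, hH, finsetSum_coeff] at hn
    obtain ⟨b, -, hb⟩ := Finset.exists_ne_zero_of_sum_ne_zero hn
    exact Finset.mem_biUnion.2 ⟨b, Finset.mem_univ _, Finset.mem_Ico.2 (hbound b n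
      (mem_support_iff.2 hb))⟩
  refine eq_zero_of_card_support_le (p := p) t (H c) ?_ ?_ ?_
  · intro n hn
    obtain ⟨b, -, hb⟩ := Finset.mem_biUnion.1 (hsupp hn)
    have h1 := (Finset.mem_Ico.1 hb).2
    have h2 := Nat.mul_le_mul_left t (show (b : ℕ) + 1 ≤ B from b.2)
    rw [mul_add] at h2
    omega
  · refine (Finset.card_le_card hsupp).trans (Finset.card_biUnion_le.trans ?_)
    simp only [Nat.card_Ico, Nat.add_sub_cancel, Finset.sum_const, Finset.card_univ,
      Fintype.card_fin, smul_eq_mul]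
    linarith
  · have hdvd : (1 - X : K[X]) ^ (t * (c : ℕ)) * (1 - X) ^ t ∣ (1 - X) ^ (t * (c : ℕ)) * H c := by
      rw [← Finset.add_sum_erase _ _ (Finset.mem_univ c)] at hF
      rw [mul_comm _ (H c), eq_neg_of_add_eq_zero_left hF]
      refine (dvd_neg).2 (Finset.dvd_sum fun i hi => ?_)
      rcases lt_or_gt_of_ne (Finset.ne_of_mem_erase hi) with h | h
      · have := hmin i h
        simp only [hH] at this
        rw [this, zero_mul]; exact dvd_zero _
      · rw [← pow_add]
        refine Dvd.dvd.mul_left (pow_dvd_pow _ ?_) _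
        have := Nat.mul_le_mul_left t (show (c : ℕ) + 1 ≤ i from h)
        linarith
    have hX : (1 - X : K[X]) ≠ 0 := by
      intro h
      have := congrArg (eval 0) h
      simp at this
    have h2 := (mul_dvd_mul_iff_left (pow_ne_zero _ hX)).1 hdvd
    have h3 : (X - C 1 : K[X]) = -(1 - X) := by simp
    rw [h3, neg_pow]
    exact ((isUnit_one.neg.pow t).mul_left_dvd).2 h2

end Stepanov

/-! ### The auxiliary polynomial and the choice of parameters. -/

namespace Stepanov

open Polynomial

variable {K : Type*} [Field K]

/-- The linear conditions under which the auxiliary polynomial vanishes to order `D`. -/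
noncomputable def conditions (t B D m : ℕ) (Ω : Finset (K × K)) :
    (Fin B → Fin B → degreeLT K m) →ₗ[K] (Ω → Fin D → degreeLT K (m + D)) :=
  LinearMap.pi fun ω => LinearMap.pi fun k =>
    LinearMap.codRestrict (degreeLT K (m + D))
      (∑ b : Fin B, ∑ c : Fin B, (ω.1.1 ^ (b : ℕ) * ω.1.2 ^ (c : ℕ)) •
        ((twistedDeriv ((t * (b : ℕ) : ℕ) : K) ((t * (c : ℕ) : ℕ) : K) ^ (k : ℕ)) ∘ₗ
          (degreeLT K m).subtype ∘ₗ LinearMap.proj c ∘ₗ LinearMap.proj b))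
      (fun R => by
        simp only [LinearMap.sum_apply]
        refine Submodule.sum_mem _ fun b _ => Submodule.sum_mem _ fun c _ => ?_
        refine Submodule.smul_mem _ _ ?_
        exact degreeLT_mono (by omega) (twistedDeriv_pow_mem_degreeLT _ _ (R b c).2 k))

theorem conditions_apply {t B D m : ℕ} {Ω : Finset (K × K)}
    (R : Fin B → Fin B → degreeLT K m) (ω : Ω) (k : Fin D) :
    (conditions t B D m Ω R ω k : K[X]) =
      ∑ b : Fin B, ∑ c : Fin B, (ω.1.1 ^ (b : ℕ) * ω.1.2 ^ (c : ℕ)) •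
        (twistedDeriv ((t * (b : ℕ) : ℕ) : K) ((t * (c : ℕ) : ℕ) : K) ^ (k : ℕ))
          (R b c : K[X]) := by
  simp [conditions, LinearMap.sum_apply]

theorem finrank_degreeLT (m : ℕ) : Module.finrank K (degreeLT K m) = m := by
  rw [(degreeLTEquiv K m).finrank_eq]; simp

theorem finite_degreeLT (m : ℕ) : Module.Finite K (degreeLT K m) :=
  Module.Finite.equiv (degreeLTEquiv K m).symm

/-- Dimension count: `B² m` unknown coefficients against `D` polynomial identities of length `m+D`
for each pair in `Ω`. -/
theorem exists_ne_zero_conditions {t B D m : ℕ} {Ω : Finset (K × K)}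
    (h : Ω.card * (D * (m + D)) < B * (B * m)) :
    ∃ R : Fin B → Fin B → degreeLT K m, R ≠ 0 ∧ conditions t B D m Ω R = 0 := by
  have := finite_degreeLT (K := K) m
  have := finite_degreeLT (K := K) (m + D)
  have hlt : Module.finrank K (Ω → Fin D → degreeLT K (m + D)) <
      Module.finrank K (Fin B → Fin B → degreeLT K m) := by
    simpa [Module.finrank_pi_fintype, finrank_degreeLT] using h
  obtain ⟨R, hR, hne⟩ := Submodule.exists_mem_ne_zero_of_ne_bot
    (LinearMap.ker_ne_bot_of_finrank_lt (f := conditions t B D m Ω) hlt)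
  exact ⟨R, hne, hR⟩

/-- Stepanov's method for the points `x` with `(x ^ t, (1 - x) ^ t)` in a given set of pairs. -/
theorem card_mul_le {p : ℕ} [CharP K p] {t B D m : ℕ} (hm : m ≤ t) (hmB : m * B ≤ t)
    (htB : t * B ≤ p) (hD : D ≤ p) (Ω : Finset (K × K))
    (h : Ω.card * (D * (m + D)) < B * (B * m)) (S : Finset K)
    (hS : ∀ x ∈ S, x ≠ 0 ∧ x ≠ 1 ∧ (x ^ t, (1 - x) ^ t) ∈ Ω) :
    S.card * D ≤ m + 2 * (t * B) := by
  obtain ⟨R, hR0, hR⟩ := exists_ne_zero_conditions (t := t) h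
  set F : K[X] := ∑ c : Fin B, (∑ b : Fin B, (R b c : K[X]) * X ^ (t * (b : ℕ))) *
    (1 - X) ^ (t * (c : ℕ)) with hF
  have hF' : F = ∑ b : Fin B, ∑ c : Fin B,
      (R b c : K[X]) * (X ^ (t * (b : ℕ)) * (1 - X) ^ (t * (c : ℕ))) := by
    rw [hF, Finset.sum_comm]
    simp only [Finset.sum_mul, mul_assoc]
  have hF0 : F ≠ 0 := by
    refine sum_ne_zero (p := p) hm hmB htB (fun b c => (R b c : K[X])) (fun b c => (R b c).2) ?_
    by_contra hcon
    push Not at hcon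
    exact hR0 (funext fun b => funext fun c => Subtype.ext (hcon b c))
  have hdvd : ∀ x ∈ S, (X - C x) ^ D ∣ F := by
    intro x hx
    obtain ⟨h0, h1, hω⟩ := hS x hx
    refine X_sub_C_pow_dvd_of_eval_eq_zero h0 h1 D hD F fun k hk => ?_
    have h2 := conditions_apply R (t := t) ⟨_, hω⟩ (⟨k, hk⟩ : Fin D)
    rw [hR] at h2
    have h3 := congrArg (eval x) h2
    simp only [Pi.zero_apply, ZeroMemClass.coe_zero, eval_zero, eval_finsetSum, eval_smul,
      smul_eq_mul] at h3
    rw [hF', map_sum, eval_finsetSum]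
    refine Eq.trans ?_ h3.symm
    refine Finset.sum_congr rfl fun b _ => ?_
    rw [map_sum, eval_finsetSum]
    refine Finset.sum_congr rfl fun c _ => ?_
    rw [twistedDeriv_pow_mul, eval_mul, eval_mul, eval_pow, eval_pow, eval_sub, eval_X, eval_one,
      pow_mul, pow_mul, mul_comm]
  have hprod : ∏ x ∈ S, (X - C x) ^ D ∣ F := by
    refine Finset.prod_dvd_of_coprime (fun x _ y _ hxy => ?_) hdvd
    exact (isCoprime_X_sub_C_of_isUnit_sub (sub_ne_zero.2 hxy).isUnit).pow
  have hle := natDegree_le_of_dvd hprod hF0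
  rw [natDegree_prod _ _ fun x _ => pow_ne_zero _ (X_sub_C_ne_zero x)] at hle
  simp only [natDegree_pow, natDegree_X_sub_C, mul_one, Finset.sum_const, smul_eq_mul] at hle
  refine hle.trans ?_
  rw [hF']
  refine natDegree_sum_le_of_forall_le _ _ fun b _ => natDegree_sum_le_of_forall_le _ _ fun c _ => ?_
  refine natDegree_mul_le.trans (add_le_add ?_ ?_)
  · exact natDegree_le_of_degree_le (mem_degreeLT.1 (R b c).2).le
  · refine natDegree_mul_le.trans ?_
    have h1 : (X ^ (t * (b : ℕ)) : K[X]).natDegree ≤ t * B := by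
      rw [natDegree_X_pow]; exact Nat.mul_le_mul_left t b.2.le
    have h2 : ((1 - X) ^ (t * (c : ℕ)) : K[X]).natDegree ≤ t * B := by
      refine natDegree_pow_le.trans ?_
      have h3 : (1 - X : K[X]).natDegree ≤ 1 := by compute_degree
      calc t * (c : ℕ) * (1 - X : K[X]).natDegree ≤ t * c * 1 := Nat.mul_le_mul_left _ h3
        _ ≤ t * B := by rw [mul_one]; exact Nat.mul_le_mul_left t c.2.le
    linarith

/-- The largest admissible `D` is used; `D+1 ≤ 2D` costs the factor `8` between `512` and `4096`. -/
theorem exists_cube_le {J t : ℕ} (hJ : 0 < J) (h : 512 * J ≤ t ^ 2) :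
    ∃ D, 0 < D ∧ 512 * (J * D ^ 3) ≤ t ^ 2 ∧ t ^ 2 ≤ 4096 * (J * D ^ 3) := by
  have hP : 512 * (J * 1 ^ 3) ≤ t ^ 2 := by simpa using h
  have hb : ∀ D, 512 * (J * D ^ 3) ≤ t ^ 2 → D ≤ t ^ 2 := fun D hD => by
    refine le_trans ?_ hD
    calc D ≤ D ^ 3 := Nat.le_self_pow (by norm_num) D
      _ ≤ J * D ^ 3 := Nat.le_mul_of_pos_left _ hJ
      _ ≤ _ := by omega
  set D := Nat.findGreatest (fun D => 512 * (J * D ^ 3) ≤ t ^ 2) (t ^ 2) with hD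
  have h1 : 1 ≤ D := Nat.le_findGreatest (hb 1 hP) hP
  refine ⟨D, h1, Nat.findGreatest_spec (P := fun D => 512 * (J * D ^ 3) ≤ t ^ 2) (hb 1 hP) hP, ?_⟩
  have h2 : ¬ 512 * (J * (D + 1) ^ 3) ≤ t ^ 2 := fun hcon =>
    absurd (Nat.le_findGreatest (P := fun D => 512 * (J * D ^ 3) ≤ t ^ 2) (hb _ hcon) hcon)
      (by omega)
  have h3 : (D + 1) ^ 3 ≤ (2 * D) ^ 3 := Nat.pow_le_pow_left (by omega) 3
  have h4 := Nat.mul_le_mul_left J h3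
  have h5 : J * (2 * D) ^ 3 = 8 * (J * D ^ 3) := by ring
  omega

theorem card_pow_three_le {p : ℕ} [CharP K p] {t : ℕ} (Ω : Finset (K × K)) (hΩ : Ω.Nonempty)
    (h1 : 512 * Ω.card ≤ t ^ 2) (h2 : Ω.card * t ^ 4 ≤ p ^ 3) (S : Finset K)
    (hS : ∀ x ∈ S, x ≠ 0 ∧ x ≠ 1 ∧ (x ^ t, (1 - x) ^ t) ∈ Ω) :
    S.card ^ 3 ≤ 64000 * (Ω.card * t) ^ 2 := by
  set J := Ω.card with hJdef
  have hJ : 0 < J := hΩ.card_pos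
  obtain ⟨D, hD, hD1, hD2⟩ := exists_cube_le hJ h1
  -- With `m = D`, the dimension count asks for `B² > 2JD`; the least such `B` keeps the degree of
  -- the auxiliary polynomial small.
  obtain ⟨B, hB1, hB2⟩ : ∃ B, 2 * (J * D) < B ^ 2 ∧ B ^ 2 ≤ 8 * (J * D) := by
    refine ⟨Nat.sqrt (2 * (J * D)) + 1, ?_, ?_⟩
    · rw [pow_two]; exact Nat.lt_succ_sqrt _
    · have hs := Nat.sqrt_le (2 * (J * D))
      have hpos : 0 < Nat.sqrt (2 * (J * D)) := Nat.sqrt_pos.2 (by positivity)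
      nlinarith
  have hDB : D * B ≤ t := by
    refine (Nat.pow_le_pow_iff_left two_ne_zero).1 ?_
    calc (D * B) ^ 2 = D ^ 2 * B ^ 2 := by ring
      _ ≤ D ^ 2 * (8 * (J * D)) := Nat.mul_le_mul_left _ hB2
      _ = 8 * (J * D ^ 3) := by ring
      _ ≤ t ^ 2 := by omega
  have hBpos : 0 < B := by
    rcases Nat.eq_zero_or_pos B with h | h
    · simp [h] at hB1
    · exact h
  -- The cube of `8` is the `512` in the choice of `D`; this is where `J t^4 ≤ p^3` enters.
  have htB : t * B ≤ p := by
    refine (Nat.pow_le_pow_iff_left (n := 6) (by norm_num)).1 ?_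
    calc (t * B) ^ 6 = t ^ 6 * (B ^ 2) ^ 3 := by ring
      _ ≤ t ^ 6 * (8 * (J * D)) ^ 3 := Nat.mul_le_mul_left _ (Nat.pow_le_pow_left hB2 3)
      _ = t ^ 6 * J ^ 2 * (512 * (J * D ^ 3)) := by ring
      _ ≤ t ^ 6 * J ^ 2 * t ^ 2 := Nat.mul_le_mul_left _ hD1
      _ = (J * t ^ 4) ^ 2 := by ring
      _ ≤ (p ^ 3) ^ 2 := Nat.pow_le_pow_left h2 2
      _ = p ^ 6 := by ring
  have hDt : D ≤ t := (Nat.le_mul_of_pos_right D hBpos).trans hDB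
  have htp : t ≤ p := (Nat.le_mul_of_pos_right t hBpos).trans htB
  have hmain := card_mul_le (p := p) hDt hDB htB (hDt.trans htp) Ω (by
    calc J * (D * (D + D)) = D * (2 * (J * D)) := by ring
      _ < D * B ^ 2 := Nat.mul_lt_mul_of_pos_left hB1 hD
      _ = B * (B * D) := by ring) S hS
  have h3 : S.card * D ≤ 3 * (t * B) := by
    have : D ≤ t * B := hDt.trans (Nat.le_mul_of_pos_right t hBpos)
    omega
  have h4 : S.card ^ 2 * D ≤ 72 * (t ^ 2 * J) := by
    refine Nat.le_of_mul_le_mul_right ?_ hD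
    calc S.card ^ 2 * D * D = (S.card * D) ^ 2 := by ring
      _ ≤ (3 * (t * B)) ^ 2 := Nat.pow_le_pow_left h3 2
      _ = 9 * t ^ 2 * B ^ 2 := by ring
      _ ≤ 9 * t ^ 2 * (8 * (J * D)) := Nat.mul_le_mul_left _ hB2
      _ = 72 * (t ^ 2 * J) * D := by ring
  refine (Nat.pow_le_pow_iff_left two_ne_zero).1 ?_
  have ht : 0 < t := hD.trans_le hDt
  refine Nat.le_of_mul_le_mul_right (c := t ^ 2) ?_ (by positivity)
  calc (S.card ^ 3) ^ 2 * t ^ 2 ≤ (S.card ^ 3) ^ 2 * (4096 * (J * D ^ 3)) :=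
        Nat.mul_le_mul_left _ hD2
    _ = 4096 * J * (S.card ^ 2 * D) ^ 3 := by ring
    _ ≤ 4096 * J * (72 * (t ^ 2 * J)) ^ 3 := Nat.mul_le_mul_left _ (Nat.pow_le_pow_left h4 3)
    _ = 1528823808 * ((J * t) ^ 4 * t ^ 2) := by ring
    -- `4096·72³` is rounded up to `64000²`, since `64000 = 40³` has an exact cube root.
    _ ≤ 4096000000 * ((J * t) ^ 4 * t ^ 2) := Nat.mul_le_mul_right _ (by norm_num)
    _ = (64000 * (J * t) ^ 2) ^ 2 * t ^ 2 := by ring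

end Stepanov

/-! ### Classes of points with equal powers, and their second moment. -/

section PowerClass

variable {K : Type*} [Field K] [Fintype K] [DecidableEq K]

/-- The points `x ≠ 0, 1` with the same values of `x ^ t` and `(1 - x) ^ t` as `u`. -/
def powerClass (t : ℕ) (u : K) : Finset K :=
  {x | x ≠ 0 ∧ x ≠ 1 ∧ x ^ t = u ^ t ∧ (1 - x) ^ t = (1 - u) ^ t}

/-- The points whose class has at least `τ` elements. -/
def powerLevel (K : Type*) [Field K] [Fintype K] [DecidableEq K] (t τ : ℕ) : Finset K :=
  {u | u ≠ 0 ∧ u ≠ 1 ∧ τ ≤ (powerClass t u).card}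

theorem mem_powerClass {t : ℕ} {u x : K} :
    x ∈ powerClass t u ↔ x ≠ 0 ∧ x ≠ 1 ∧ x ^ t = u ^ t ∧ (1 - x) ^ t = (1 - u) ^ t := by
  simp [powerClass]

theorem mem_powerLevel {t τ : ℕ} {u : K} :
    u ∈ powerLevel K t τ ↔ u ≠ 0 ∧ u ≠ 1 ∧ τ ≤ (powerClass t u).card := by
  simp [powerLevel]

theorem card_powerClass_le {t : ℕ} (ht : 0 < t) (u : K) : (powerClass t u).card ≤ t := by
  refine le_trans (Finset.card_le_card fun x hx => ?_)
    ((Multiset.toFinset_card_le _).trans (Polynomial.card_nthRoots t (u ^ t)))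
  rw [Multiset.mem_toFinset, Polynomial.mem_nthRoots ht]
  exact (mem_powerClass.1 hx).2.2.1

theorem powerClass_eq_of_mem {t : ℕ} {u x : K} (hx : x ∈ powerClass t u) :
    powerClass t x = powerClass t u := by
  obtain ⟨-, -, h1, h2⟩ := mem_powerClass.1 hx
  ext y
  rw [mem_powerClass, mem_powerClass, h1, h2]

theorem powerLevel_anti {t σ τ : ℕ} (h : σ ≤ τ) : powerLevel K t τ ⊆ powerLevel K t σ := by
  intro u hu
  rw [mem_powerLevel] at hu ⊢
  exact ⟨hu.1, hu.2.1, h.trans hu.2.2⟩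

theorem card_nthRootsFinset_le {K : Type*} [Field K] (t : ℕ) :
    (Polynomial.nthRootsFinset t (1 : K)).card ≤ t := by
  classical
  rw [Polynomial.nthRootsFinset_def]
  exact (Multiset.toFinset_card_le _).trans (Polynomial.card_nthRoots t 1)

/-- A second point `x` in the class of `u` gives `t`-th roots of unity `g = x/u` and `h =
(1-x)/(1-u)`, and these determine `u = (1-h)/(g-h)`. -/
theorem card_powerLevel_two_le {t : ℕ} (ht : 0 < t) : (powerLevel K t 2).card ≤ t ^ 2 := by
  set G := Polynomial.nthRootsFinset t (1 : K)
  have hG : G.card ≤ t := card_nthRootsFinset_le t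
  have hsub : powerLevel K t 2 ⊆ (G ×ˢ G).image fun q => (1 - q.2) / (q.1 - q.2) := by
    intro u hu
    obtain ⟨hu0, hu1, hu2⟩ := mem_powerLevel.1 hu
    obtain ⟨x, hx, hxu⟩ := Finset.exists_mem_ne (s := powerClass t u) (by omega) u
    obtain ⟨hx0, hx1, h1, h2⟩ := mem_powerClass.1 hx
    have hu1' : 1 - u ≠ 0 := sub_ne_zero.2 (Ne.symm hu1)
    refine Finset.mem_image.2 ⟨(x / u, (1 - x) / (1 - u)), ?_, ?_⟩
    · rw [Finset.mem_product, Polynomial.mem_nthRootsFinset ht, Polynomial.mem_nthRootsFinset ht]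
      simp only
      rw [div_pow, div_pow, h1, h2, div_self (pow_ne_zero _ hu0), div_self (pow_ne_zero _ hu1')]
      exact ⟨rfl, rfl⟩
    · have hxu' : x - u ≠ 0 := sub_ne_zero.2 hxu
      have e1 : 1 - (1 - x) / (1 - u) = (x - u) / (1 - u) := by field_simp; ring
      have e2 : x / u - (1 - x) / (1 - u) = (x - u) / (u * (1 - u)) := by field_simp; ring
      simp only
      rw [e1, e2]
      field_simp
  refine (Finset.card_le_card hsub).trans (Finset.card_image_le.trans ?_)
  rw [Finset.card_product, pow_two]
  exact Nat.mul_le_mul hG hG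

/-- The fibre of a level set over each pair of values it takes has at least `τ` elements. -/
theorem mul_card_le_card_filter {t τ : ℕ} (Ω : Finset (K × K))
    (hΩ : Ω ⊆ (powerLevel K t τ).image fun x => (x ^ t, (1 - x) ^ t)) :
    τ * Ω.card ≤ ((powerLevel K t τ).filter fun x => (x ^ t, (1 - x) ^ t) ∈ Ω).card := by
  rw [Finset.card_eq_sum_card_fiberwise (t := Ω) (f := fun x : K => (x ^ t, (1 - x) ^ t))
    (s := (powerLevel K t τ).filter fun x => (x ^ t, (1 - x) ^ t) ∈ Ω)
    (fun x hx => (Finset.mem_filter.1 (Finset.mem_coe.1 hx)).2), mul_comm, ← smul_eq_mul]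
  refine Finset.card_nsmul_le_sum _ _ _ fun ω hω => ?_
  obtain ⟨u, hu, rfl⟩ := Finset.mem_image.1 (hΩ hω)
  refine (mem_powerLevel.1 hu).2.2.trans (Finset.card_le_card fun x hx => ?_)
  obtain ⟨hx0, hx1, h1, h2⟩ := mem_powerClass.1 hx
  have h3 : x ∈ powerLevel K t τ :=
    mem_powerLevel.2 ⟨hx0, hx1, by rw [powerClass_eq_of_mem hx]; exact (mem_powerLevel.1 hu).2.2⟩
  simp only [Finset.mem_filter]
  exact ⟨⟨h3, by rw [h1, h2]; exact hω⟩, by rw [h1, h2]⟩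

theorem card_powerLevel_le {p : ℕ} [CharP K p] {t τ L : ℕ} (hL : 0 < L) (ht : 0 < t)
    (htp : t ^ 2 ≤ L * p) (hτ : 2 ≤ τ) :
    (powerLevel K t τ).card * τ ^ 2 ≤ 65536000 * L ^ 3 * t ^ 2 := by
  set s := (powerLevel K t τ).card with hs
  set Ω := (powerLevel K t τ).image fun x => (x ^ t, (1 - x) ^ t) with hΩ
  have hst : s ≤ t ^ 2 := (Finset.card_le_card (powerLevel_anti hτ)).trans
    (card_powerLevel_two_le ht)
  have hL3 : 1 ≤ L ^ 3 := Nat.one_le_pow _ _ hL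
  have hmem : ∀ Ω' : Finset (K × K), ∀ x ∈ (powerLevel K t τ).filter
      (fun x => (x ^ t, (1 - x) ^ t) ∈ Ω'), x ≠ 0 ∧ x ≠ 1 ∧ (x ^ t, (1 - x) ^ t) ∈ Ω' :=
    fun Ω' x hx => ⟨(mem_powerLevel.1 (Finset.mem_filter.1 hx).1).1,
      (mem_powerLevel.1 (Finset.mem_filter.1 hx).1).2.1, (Finset.mem_filter.1 hx).2⟩
  have hsmall : ∀ J, 512 * L ^ 3 * J ≤ t ^ 2 → 512 * J ≤ t ^ 2 ∧ J * t ^ 4 ≤ p ^ 3 := by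
    intro J hJ
    refine ⟨le_trans (by nlinarith [Nat.zero_le J]) hJ, ?_⟩
    refine le_of_mul_le_mul_left ?_ (show 0 < L ^ 3 by positivity)
    calc L ^ 3 * (J * t ^ 4) = (L ^ 3 * J) * t ^ 4 := by ring
      _ ≤ t ^ 2 * t ^ 4 := Nat.mul_le_mul_right _ (by nlinarith)
      _ = (t ^ 2) ^ 3 := by ring
      _ ≤ (L * p) ^ 3 := Nat.pow_le_pow_left htp 3
      _ = L ^ 3 * p ^ 3 := by ring
  rcases (powerLevel K t τ).eq_empty_or_nonempty with hempty | hne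
  · simp [hs, hempty]
  -- When `Ω` is small enough, Stepanov's bound applies to the whole level set and is combined with
  -- `τ|Ω| ≤ s`.
  rcases le_or_gt (512 * L ^ 3 * Ω.card) (t ^ 2) with hcase | hcase
  · obtain ⟨h1, h2⟩ := hsmall _ hcase
    have hΩ0 : Ω.Nonempty := hne.image _
    have h3 := Stepanov.card_pow_three_le (p := p) (t := t) Ω hΩ0 h1 h2 _ (hmem Ω)
    have h4 := mul_card_le_card_filter (t := t) (τ := τ) Ω (le_refl _)
    have h5 : (powerLevel K t τ).filter (fun x => (x ^ t, (1 - x) ^ t) ∈ Ω) = powerLevel K t τ :=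
      Finset.filter_true_of_mem fun x hx => Finset.mem_image_of_mem _ hx
    rw [h5, ← hs] at h3 h4
    have hspos : 0 < s := hne.card_pos
    have h6 : s * τ ^ 2 ≤ 64000 * t ^ 2 := by
      refine le_of_mul_le_mul_left ?_ (show 0 < s ^ 2 by positivity)
      calc s ^ 2 * (s * τ ^ 2) = s ^ 3 * τ ^ 2 := by ring
        _ ≤ 64000 * (Ω.card * t) ^ 2 * τ ^ 2 := Nat.mul_le_mul_right _ h3
        _ = 64000 * t ^ 2 * (τ * Ω.card) ^ 2 := by ring
        _ ≤ 64000 * t ^ 2 * s ^ 2 := Nat.mul_le_mul_left _ (Nat.pow_le_pow_left h4 2)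
        _ = s ^ 2 * (64000 * t ^ 2) := by ring
    refine h6.trans (Nat.mul_le_mul_right _ ?_)
    omega
  -- Otherwise only `J` of the pairs are kept, the most that Stepanov's bound permits. This bounds
  -- `τ` itself, after which `s ≤ t²` suffices.
  · set J := t ^ 2 / (512 * L ^ 3) with hJ
    have hJ1 : 512 * L ^ 3 * J ≤ t ^ 2 := Nat.mul_div_le _ _
    have hJ2 : t ^ 2 < 512 * L ^ 3 * (J + 1) := Nat.lt_mul_div_succ _ (by positivity)
    rcases Nat.eq_zero_or_pos J with hJ0 | hJ0
    · rw [hJ0, zero_add, mul_one] at hJ2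
      obtain ⟨u, hu⟩ := hne
      have hτt : τ ≤ t := (mem_powerLevel.1 hu).2.2.trans (card_powerClass_le ht u)
      calc s * τ ^ 2 ≤ t ^ 2 * t ^ 2 := Nat.mul_le_mul hst (Nat.pow_le_pow_left hτt 2)
        _ ≤ 65536000 * L ^ 3 * t ^ 2 := Nat.mul_le_mul_right _ (by omega)
    · have hJN : J ≤ Ω.card := by
        have := hJ1.trans_lt hcase
        exact (Nat.lt_of_mul_lt_mul_left this).le
      obtain ⟨Ω', hΩ', hcard⟩ := Finset.exists_subset_card_eq hJN
      obtain ⟨h1, h2⟩ := hsmall _ hJ1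
      rw [← hcard] at h1 h2
      have h3 := Stepanov.card_pow_three_le (p := p) (t := t) Ω'
        (Finset.card_pos.1 (by omega)) h1 h2 _ (hmem Ω')
      have h4 := mul_card_le_card_filter (t := t) (τ := τ) Ω' hΩ'
      rw [hcard] at h3 h4
      have h5 : τ ^ 3 * J ≤ 64000 * t ^ 2 := by
        refine le_of_mul_le_mul_left ?_ (show 0 < J ^ 2 by positivity)
        calc J ^ 2 * (τ ^ 3 * J) = (τ * J) ^ 3 := by ring
          _ ≤ _ := Nat.pow_le_pow_left h4 3
          _ ≤ 64000 * (J * t) ^ 2 := h3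
          _ = J ^ 2 * (64000 * t ^ 2) := by ring
      have h6 : τ ^ 3 ≤ 65536000 * L ^ 3 := by
        refine Nat.le_of_mul_le_mul_right (c := J) ?_ hJ0
        calc τ ^ 3 * J ≤ 64000 * t ^ 2 := h5
          _ ≤ 64000 * (512 * L ^ 3 * (J + 1)) := Nat.mul_le_mul_left _ hJ2.le
          _ ≤ 64000 * (512 * L ^ 3 * (2 * J)) :=
            Nat.mul_le_mul_left _ (Nat.mul_le_mul_left _ (by omega))
          _ = 65536000 * L ^ 3 * J := by ring
      calc s * τ ^ 2 ≤ t ^ 2 * τ ^ 3 :=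
            Nat.mul_le_mul hst (Nat.pow_le_pow_right (by omega) (by norm_num))
        _ ≤ t ^ 2 * (65536000 * L ^ 3) := Nat.mul_le_mul_left _ h6
        _ = 65536000 * L ^ 3 * t ^ 2 := by ring

/-- The sum equals `n² + n - 2`. It starts at `2` because the level-set bound is available only for
`τ ≥ 2`. -/
theorem sq_le_sum_Icc {n t : ℕ} (h2 : 2 ≤ n) (hn : n ≤ t) :
    n ^ 2 ≤ ∑ τ ∈ Finset.Icc 2 t, if τ ≤ n then 2 * τ else 0 := by
  rw [← Finset.sum_filter]
  have hsub : Finset.Icc 2 n ⊆ (Finset.Icc 2 t).filter (· ≤ n) := fun τ hτ => by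
    simp only [Finset.mem_Icc, Finset.mem_filter] at hτ ⊢
    omega
  refine le_trans ?_ (Finset.sum_le_sum_of_subset hsub)
  clear hsub hn
  induction n, h2 using Nat.le_induction with
  | base => decide
  | succ n hn ih =>
    rw [Finset.sum_Icc_succ_top (by omega)]
    nlinarith

theorem sum_inv_Icc_two_le {t : ℕ} (ht : 1 ≤ t) :
    ∑ τ ∈ Finset.Icc 2 t, (τ : ℝ)⁻¹ ≤ Real.log t := by
  have h := harmonic_le_one_add_log t
  rw [harmonic_eq_sum_Icc, ← Finset.add_sum_Ioc_eq_sum_Icc ht] at h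
  push_cast at h
  have h2 : Finset.Ioc 1 t = Finset.Icc 2 t := by ext; simp [Nat.succ_le_iff]
  rw [h2] at h
  norm_num at h
  exact h

theorem sum_card_powerClass_sq_le {p : ℕ} [CharP K p] {t L : ℕ} (hL : 0 < L) (ht : 0 < t)
    (htp : t ^ 2 ≤ L * p) :
    ((∑ u ∈ powerLevel K t 2, (powerClass t u).card ^ 2 : ℕ) : ℝ) ≤
      131072000 * L ^ 3 * t ^ 2 * Real.log t := by
  have h1 : ∑ u ∈ powerLevel K t 2, (powerClass t u).card ^ 2 ≤
      ∑ τ ∈ Finset.Icc 2 t, 2 * τ * (powerLevel K t τ).card := by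
    calc _ ≤ ∑ u ∈ powerLevel K t 2, ∑ τ ∈ Finset.Icc 2 t,
          (if τ ≤ (powerClass t u).card then 2 * τ else 0) :=
        Finset.sum_le_sum fun u hu =>
          sq_le_sum_Icc (mem_powerLevel.1 hu).2.2 (card_powerClass_le ht u)
      _ = ∑ τ ∈ Finset.Icc 2 t, ∑ u ∈ powerLevel K t 2,
          (if τ ≤ (powerClass t u).card then 2 * τ else 0) := Finset.sum_comm
      _ ≤ _ := Finset.sum_le_sum fun τ _ => by
        rw [← Finset.sum_filter, Finset.sum_const, smul_eq_mul, mul_comm]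
        refine Nat.mul_le_mul_left _ (Finset.card_le_card fun u hu => ?_)
        obtain ⟨h3, h4⟩ := Finset.mem_filter.1 hu
        exact mem_powerLevel.2 ⟨(mem_powerLevel.1 h3).1, (mem_powerLevel.1 h3).2.1, h4⟩
  calc ((∑ u ∈ powerLevel K t 2, (powerClass t u).card ^ 2 : ℕ) : ℝ)
      ≤ ((∑ τ ∈ Finset.Icc 2 t, 2 * τ * (powerLevel K t τ).card : ℕ) : ℝ) := by exact_mod_cast h1
    _ = ∑ τ ∈ Finset.Icc 2 t, 2 * (τ : ℝ) * (powerLevel K t τ).card := by push_cast; rfl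
    _ ≤ ∑ τ ∈ Finset.Icc 2 t, 131072000 * L ^ 3 * t ^ 2 * (τ : ℝ)⁻¹ := by
      refine Finset.sum_le_sum fun τ hτ => ?_
      have hτ2 := (Finset.mem_Icc.1 hτ).1
      have hτ0 : (0 : ℝ) < τ := by exact_mod_cast (by omega : 0 < τ)
      have h3 : ((powerLevel K t τ).card : ℝ) * τ ^ 2 ≤ 65536000 * L ^ 3 * t ^ 2 := by
        exact_mod_cast card_powerLevel_le (K := K) (p := p) hL ht htp hτ2
      rw [← div_eq_mul_inv, le_div_iff₀ hτ0]
      nlinarith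
    _ = 131072000 * L ^ 3 * t ^ 2 * ∑ τ ∈ Finset.Icc 2 t, (τ : ℝ)⁻¹ := by rw [Finset.mul_sum]
    _ ≤ _ := mul_le_mul_of_nonneg_left (sum_inv_Icc_two_le ht) (by positivity)

end PowerClass

/-! ### Counting triples by their ratio. -/

section Triples

variable {K : Type*} [DecidableEq K]

/-- Triples of pairwise distinct elements of `A`. -/
def distinctTriples (A : Finset K) : Finset (K × K × K) :=
  (A ×ˢ A ×ˢ A).filter fun q => q.1 ≠ q.2.1 ∧ q.1 ≠ q.2.2 ∧ q.2.1 ≠ q.2.2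

theorem mem_distinctTriples {A : Finset K} {a b c : K} :
    (a, b, c) ∈ distinctTriples A ↔
      (a ∈ A ∧ b ∈ A ∧ c ∈ A) ∧ a ≠ b ∧ a ≠ c ∧ b ≠ c := by
  simp [distinctTriples]

theorem card_pow_three_le_distinctTriples (A : Finset K) :
    A.card ^ 3 ≤ (distinctTriples A).card + 3 * A.card ^ 2 := by
  have hsub : A ×ˢ A ×ˢ A ⊆ distinctTriples A ∪
      ((A ×ˢ A).image (fun q => (q.1, q.1, q.2)) ∪ ((A ×ˢ A).image (fun q => (q.1, q.2, q.1)) ∪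
        (A ×ˢ A).image (fun q => (q.2, q.1, q.1)))) := by
    rintro ⟨a, b, c⟩ h
    simp only [Finset.mem_product] at h
    simp only [Finset.mem_union, Finset.mem_image, Finset.mem_product, mem_distinctTriples,
      Prod.exists, Prod.mk.injEq]
    by_cases hab : a = b
    · exact Or.inr (Or.inl ⟨a, c, ⟨h.1, h.2.2⟩, rfl, hab, rfl⟩)
    by_cases hac : a = c
    · exact Or.inr (Or.inr (Or.inl ⟨a, b, ⟨h.1, h.2.1⟩, rfl, rfl, hac⟩))
    by_cases hbc : b = c
    · exact Or.inr (Or.inr (Or.inr ⟨b, a, ⟨h.2.1, h.1⟩, rfl, rfl, hbc⟩))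
    exact Or.inl ⟨h, hab, hac, hbc⟩
  have hcard : ∀ f : K × K → K × K × K, ((A ×ˢ A).image f).card ≤ A.card ^ 2 := fun f =>
    Finset.card_image_le.trans (by rw [Finset.card_product, pow_two])
  have h1 := Finset.card_le_card hsub
  rw [Finset.card_product, Finset.card_product] at h1
  have h2 := h1.trans ((Finset.card_union_le _ _).trans (Nat.add_le_add_left
    ((Finset.card_union_le _ _).trans (Nat.add_le_add_left (Finset.card_union_le _ _) _)) _))
  have h3 := hcard fun q => (q.1, q.1, q.2)
  have h4 := hcard fun q => (q.1, q.2, q.1)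
  have h5 := hcard fun q => (q.2, q.1, q.1)
  calc A.card ^ 3 = A.card * (A.card * A.card) := by ring
    _ ≤ _ := by omega

variable [Field K]

/-- The ratio `(a - b) / (a - c)` attached to a triple. -/
def tripleRatio (q : K × K × K) : K := (q.1 - q.2.1) / (q.1 - q.2.2)

theorem tripleRatio_ne_zero_one {A : Finset K} {q : K × K × K} (hq : q ∈ distinctTriples A) :
    tripleRatio q ≠ 0 ∧ tripleRatio q ≠ 1 := by
  obtain ⟨a, b, c⟩ := q
  obtain ⟨-, hab, hac, hbc⟩ := mem_distinctTriples.1 hq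
  refine ⟨div_ne_zero (sub_ne_zero.2 hab) (sub_ne_zero.2 hac), fun h => hbc ?_⟩
  have h1 := (div_eq_one_iff_eq (sub_ne_zero.2 hac)).1 h
  exact sub_right_injective h1

/-- For fixed `a ≠ c` the ratio is injective in `b`, which leaves `|A| - 2` values. -/
theorem card_le_card_add_two {A V : Finset K}
    (hV : ∀ q ∈ distinctTriples A, tripleRatio q ∈ V) : A.card ≤ V.card + 2 := by
  rcases le_or_gt A.card 1 with h | h
  · omega
  obtain ⟨a, ha, c, hc, hac⟩ := Finset.one_lt_card.1 h
  have h1 : ((A.erase a).erase c).card ≤ V.card := by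
    refine Finset.card_le_card_of_injOn (fun b => tripleRatio (a, b, c)) ?_ ?_
    · intro b hb
      obtain ⟨hbc, hb⟩ := Finset.mem_erase.1 (Finset.mem_coe.1 hb)
      obtain ⟨hba, hb⟩ := Finset.mem_erase.1 hb
      exact hV _ (mem_distinctTriples.2 ⟨⟨ha, hb, hc⟩, hba.symm, hac, hbc⟩)
    · intro b _ b' _ h
      exact sub_right_injective ((div_left_inj' (sub_ne_zero.2 hac)).1 h)
  rw [Finset.card_erase_of_mem (Finset.mem_erase.2 ⟨hac.symm, hc⟩),
    Finset.card_erase_of_mem ha] at h1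
  omega

variable [Fintype K]

theorem div_mem_powerClass {A : Finset K} {t : ℕ} (hA : ∀ x ∈ A, x ^ t = 1) (h0 : (0 : K) ∉ A)
    {a b c : K} (hq : (a, b, c) ∈ distinctTriples A) {v : K} (hv : tripleRatio (a, b, c) = v) :
    b / a / (1 - v) ∈ powerClass t (1 / (1 - v)) := by
  obtain ⟨⟨ha, hb, hc⟩, hab, hac, hbc⟩ := mem_distinctTriples.1 hq
  obtain ⟨hv0, hv1⟩ := tripleRatio_ne_zero_one hq
  rw [hv] at hv0 hv1
  have ha0 : a ≠ 0 := fun h => h0 (h ▸ ha)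
  have hb0 : b ≠ 0 := fun h => h0 (h ▸ hb)
  have hc0 : c ≠ 0 := fun h => h0 (h ▸ hc)
  have hv1' : 1 - v ≠ 0 := sub_ne_zero.2 (Ne.symm hv1)
  have hab' : a - b = v * (a - c) := (div_eq_iff (sub_ne_zero.2 hac)).1 hv
  have h1 : 1 - b / a / (1 - v) = (1 - 1 / (1 - v)) * (c / a) := by
    field_simp
    linear_combination hab'
  have h2 : (1 : K) - 1 / (1 - v) ≠ 0 := by
    have : (1 : K) - 1 / (1 - v) = -v / (1 - v) := by field_simp; ring
    rw [this]
    exact div_ne_zero (neg_ne_zero.2 hv0) hv1'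
  refine mem_powerClass.2 ⟨div_ne_zero (div_ne_zero hb0 ha0) hv1', fun h => ?_, ?_, ?_⟩
  · rw [h, sub_self] at h1
    exact mul_ne_zero h2 (div_ne_zero hc0 ha0) h1.symm
  · rw [div_pow, div_pow, div_pow, hA a ha, hA b hb]; simp
  · rw [h1, mul_pow, div_pow c a, hA a ha, hA c hc]; simp

/-- For given `v`, the triple is recovered from `a` and the class member `x = b/(a(1-v))`: these
give `b`, and `v ≠ 0` then gives `c`. -/
theorem card_fiber_tripleRatio_le {A : Finset K} {t : ℕ} (ht : 0 < t) (hA : ∀ x ∈ A, x ^ t = 1)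
    (v : K) :
    ((distinctTriples A).filter fun q => tripleRatio q = v).card ≤
      t * (powerClass t (1 / (1 - v))).card := by
  have h0 : (0 : K) ∉ A := fun h => by simpa [ht.ne'] using hA 0 h
  have hcard : A.card ≤ t := by
    refine (Finset.card_le_card fun x hx => ?_).trans (card_nthRootsFinset_le (K := K) t)
    exact (Polynomial.mem_nthRootsFinset ht _).2 (hA x hx)
  refine le_trans ?_ (Nat.mul_le_mul_right _ hcard)
  rw [← Finset.card_product]
  refine Finset.card_le_card_of_injOn (fun q => (q.1, q.2.1 / q.1 / (1 - v))) ?_ ?_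
  · rintro ⟨a, b, c⟩ hq
    obtain ⟨hq, hv⟩ := Finset.mem_filter.1 (Finset.mem_coe.1 hq)
    exact Finset.mem_coe.2 (Finset.mem_product.2
      ⟨(mem_distinctTriples.1 hq).1.1, div_mem_powerClass hA h0 hq hv⟩)
  · rintro ⟨a, b, c⟩ hq ⟨a', b', c'⟩ hq' heq
    obtain ⟨hq, hv⟩ := Finset.mem_filter.1 (Finset.mem_coe.1 hq)
    obtain ⟨hq', hv'⟩ := Finset.mem_filter.1 (Finset.mem_coe.1 hq')
    simp only [Prod.mk.injEq] at heq
    obtain ⟨rfl, hb⟩ := heq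
    obtain ⟨hv0, hv1⟩ := tripleRatio_ne_zero_one hq
    rw [hv] at hv0 hv1
    obtain ⟨⟨ha, -, -⟩, -, hac, -⟩ := mem_distinctTriples.1 hq
    obtain ⟨-, -, hac', -⟩ := mem_distinctTriples.1 hq'
    have ha0 : a ≠ 0 := fun h => h0 (h ▸ ha)
    have hv1' : 1 - v ≠ 0 := sub_ne_zero.2 (Ne.symm hv1)
    have hbb : b = b' := (div_left_inj' ha0).1 ((div_left_inj' hv1').1 hb)
    subst hbb
    have e1 : a - b = v * (a - c) := (div_eq_iff (sub_ne_zero.2 hac)).1 hv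
    have e2 : a - b = v * (a - c') := (div_eq_iff (sub_ne_zero.2 hac')).1 hv'
    have e3 : c = c' := sub_right_injective (mul_left_cancel₀ hv0 (e1.symm.trans e2))
    rw [e3]

/-- The class contains both `u` and `u·b/a`, which differ because `a ≠ b`. Hence only classes of
size at least `2` enter the second moment. -/
theorem inv_one_sub_tripleRatio_mem_powerLevel {A : Finset K} {t : ℕ} (ht : 0 < t)
    (hA : ∀ x ∈ A, x ^ t = 1) {q : K × K × K} (hq : q ∈ distinctTriples A) :
    1 / (1 - tripleRatio q) ∈ powerLevel K t 2 := by
  have h0 : (0 : K) ∉ A := fun h => by simpa [ht.ne'] using hA 0 h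
  obtain ⟨hv0, hv1⟩ := tripleRatio_ne_zero_one hq
  obtain ⟨a, b, c⟩ := q
  have hmem := div_mem_powerClass hA h0 hq rfl
  set v := tripleRatio (a, b, c)
  obtain ⟨⟨ha, -, -⟩, hab, -, -⟩ := mem_distinctTriples.1 hq
  have ha0 : a ≠ 0 := fun h => h0 (h ▸ ha)
  have hv1' : 1 - v ≠ 0 := sub_ne_zero.2 (Ne.symm hv1)
  have hu0 : 1 / (1 - v) ≠ 0 := one_div_ne_zero hv1'
  have hu1 : 1 / (1 - v) ≠ 1 := fun h => by
    rw [div_eq_one_iff_eq hv1'] at h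
    exact hv0 (by linear_combination h)
  refine mem_powerLevel.2 ⟨hu0, hu1, ?_⟩
  have hlt : 1 < (powerClass t (1 / (1 - v))).card := by
    refine Finset.one_lt_card.2 ⟨_, hmem, _, mem_powerClass.2 ⟨hu0, hu1, rfl, rfl⟩, fun h => ?_⟩
    exact hab ((div_eq_one_iff_eq ha0).1 ((div_left_inj' hv1').1 h)).symm
  exact hlt

theorem card_distinctTriples_sq_le {A V : Finset K} {t : ℕ} (ht : 0 < t)
    (hA : ∀ x ∈ A, x ^ t = 1) (hV : ∀ q ∈ distinctTriples A, tripleRatio q ∈ V) :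
    (distinctTriples A).card ^ 2 ≤
      V.card * (t ^ 2 * ∑ u ∈ powerLevel K t 2, (powerClass t u).card ^ 2) := by
  set W := (distinctTriples A).image tripleRatio with hW
  have hWV : W ⊆ V := Finset.image_subset_iff.2 hV
  rw [Finset.card_eq_sum_card_image tripleRatio]
  refine (sq_sum_le_card_mul_sum_sq).trans (Nat.mul_le_mul (Finset.card_le_card hWV) ?_)
  calc ∑ v ∈ W, ((distinctTriples A).filter fun q => tripleRatio q = v).card ^ 2
      ≤ ∑ v ∈ W, t ^ 2 * (powerClass t (1 / (1 - v))).card ^ 2 :=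
        Finset.sum_le_sum fun v _ => by
          rw [← mul_pow]; exact Nat.pow_le_pow_left (card_fiber_tripleRatio_le ht hA v) 2
    _ = t ^ 2 * ∑ v ∈ W, (powerClass t (1 / (1 - v))).card ^ 2 := by rw [Finset.mul_sum]
    _ = t ^ 2 * ∑ u ∈ W.image (fun v => 1 / (1 - v)), (powerClass t u).card ^ 2 := by
        rw [Finset.sum_image (s := W) (g := fun v : K => 1 / (1 - v))]
        intro v _ w _ h
        simpa using h
    _ ≤ _ := Nat.mul_le_mul_left _ (Finset.sum_le_sum_of_subset fun u hu => by
        obtain ⟨v, hv, rfl⟩ := Finset.mem_image.1 hu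
        obtain ⟨q, hq, rfl⟩ := Finset.mem_image.1 hv
        exact inv_one_sub_tripleRatio_mem_powerLevel ht hA hq)

/-- The elements `v` for which both `v` and `1 - v` are `T`-th roots of unity. -/
def unitPairs (K : Type*) [Field K] [Fintype K] [DecidableEq K] (T : ℕ) : Finset K :=
  {v | v ^ T = 1 ∧ (1 - v) ^ T = 1}

theorem card_unitPairs_le {T : ℕ} (hT : 0 < T) : (unitPairs K T).card ≤ T := by
  refine (Finset.card_le_card fun x hx => ?_).trans (card_nthRootsFinset_le (K := K) T)
  exact (Polynomial.mem_nthRootsFinset hT _).2 (Finset.mem_filter.1 hx).2.1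

theorem card_unitPairs_pow_three_le {p : ℕ} [CharP K p] {T : ℕ} (hT : 0 < T)
    (hTp : T ^ 4 ≤ p ^ 3) : (unitPairs K T).card ^ 3 ≤ 64000 * T ^ 2 := by
  rcases lt_or_ge (T ^ 2) 512 with h | h
  · have h1 : T < 23 := by nlinarith
    calc (unitPairs K T).card ^ 3 ≤ T ^ 3 := Nat.pow_le_pow_left (card_unitPairs_le hT) 3
      _ = T * T ^ 2 := by ring
      _ ≤ 64000 * T ^ 2 := Nat.mul_le_mul_right _ (by omega)
  -- Stepanov's bound for the single pair `(1, 1)`, so `J = 1`.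
  · have := Stepanov.card_pow_three_le (p := p) (t := T) {((1 : K), (1 : K))}
      (Finset.singleton_nonempty _) (by simpa using h) (by simpa using hTp) (unitPairs K T) ?_
    · simpa using this
    · intro x hx
      obtain ⟨h1, h2⟩ := (Finset.mem_filter.1 hx).2
      refine ⟨fun h => ?_, fun h => ?_, by simp [h1, h2]⟩
      · simp [h, hT.ne'] at h1
      · simp [h, hT.ne'] at h2

theorem card_unitPairs_le_rpow {p : ℕ} [CharP K p] {T : ℕ} (hT : 0 < T) (hTp : T ^ 4 ≤ p ^ 3) :
    ((unitPairs K T).card : ℝ) ≤ 40 * (T : ℝ) ^ (2 / 3 : ℝ) := by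
  refine le_of_pow_le_pow_left₀ three_ne_zero (by positivity) ?_
  have h1 : ((T : ℝ) ^ (2 / 3 : ℝ)) ^ 3 = (T : ℝ) ^ 2 := by
    rw [← Real.rpow_natCast, ← Real.rpow_mul (by positivity)]
    norm_num
  have h2 : ((unitPairs K T).card : ℝ) ^ 3 ≤ 64000 * (T : ℝ) ^ 2 := by
    exact_mod_cast card_unitPairs_pow_three_le (K := K) (p := p) hT hTp
  rw [mul_pow, h1]
  linarith

theorem one_le_logb_two {t : ℕ} (ht : 2 ≤ t) : 1 ≤ Real.logb 2 t := by
  have ht' : (2 : ℝ) ≤ t := by exact_mod_cast ht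
  rw [Real.le_logb_iff_rpow_le one_lt_two (by linarith)]
  simpa using ht'

theorem log_le_logb_two {t : ℕ} (ht : 2 ≤ t) : Real.log t ≤ Real.logb 2 t := by
  have ht' : (2 : ℝ) ≤ t := by exact_mod_cast ht
  rw [Real.logb, le_div_iff₀ (Real.log_pos one_lt_two)]
  have h1 := Real.log_two_lt_d9
  have h2 : 0 ≤ Real.log t := Real.log_nonneg (by linarith)
  nlinarith

/-- The sixth power bound for a set of `t`-th roots of unity all of whose ratios
`(a - b) / (a - c)` and `1 - (a - b) / (a - c)` are `T`-th roots of unity. -/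
theorem card_pow_six_le {p : ℕ} [CharP K p] {A : Finset K} {t T L : ℕ} (hL : 0 < L) (ht : 2 ≤ t)
    (htp : t ^ 2 ≤ L * p) (hT : 0 < T) (hTp : T ^ 4 ≤ p ^ 3) (hA : ∀ x ∈ A, x ^ t = 1)
    (hV : ∀ q ∈ distinctTriples A, tripleRatio q ∈ unitPairs K T) :
    (A.card : ℝ) ^ 6 ≤ 20971520000 * L ^ 3 *
      ((t : ℝ) ^ 4 * (T : ℝ) ^ (2 / 3 : ℝ) * Real.logb 2 t) := by
  set N := A.card with hN
  have ht' : (2 : ℝ) ≤ t := by exact_mod_cast ht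
  have hL' : (1 : ℝ) ≤ L := by exact_mod_cast hL
  have hT' : (1 : ℝ) ≤ T := by exact_mod_cast hT
  have hlog1 := one_le_logb_two ht
  have hlog2 := log_le_logb_two ht
  have hTr : 1 ≤ (T : ℝ) ^ (2 / 3 : ℝ) := Real.one_le_rpow hT' (by norm_num)
  rcases lt_or_ge N 6 with h6 | h6
  · have h1 : (N : ℝ) ^ 6 ≤ 6 ^ 6 := by
      refine pow_le_pow_left₀ (by positivity) ?_ 6
      exact_mod_cast h6.le
    have h2 : 1 ≤ (t : ℝ) ^ 4 := one_le_pow₀ (by linarith)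
    have h3 : 1 ≤ (L : ℝ) ^ 3 := one_le_pow₀ hL'
    have h4 : 1 ≤ (t : ℝ) ^ 4 * (T : ℝ) ^ (2 / 3 : ℝ) * Real.logb 2 t :=
      one_le_mul_of_one_le_of_one_le (one_le_mul_of_one_le_of_one_le h2 hTr) hlog1
    have h5 := one_le_mul_of_one_le_of_one_le h3 h4
    rw [mul_assoc]
    linarith
  have hc := card_pow_three_le_distinctTriples A
  rw [← hN] at hc
  -- For `N ≥ 6` the degenerate triples, at most `3N²`, are at most half of all.
  have hc2 : N ^ 3 ≤ 2 * (distinctTriples A).card := by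
    have h1 := Nat.mul_le_mul_right (N ^ 2) h6
    have h2 : N * N ^ 2 = N ^ 3 := by ring
    omega
  have hsq := card_distinctTriples_sq_le (by omega : 0 < t) hA hV
  have hsum := sum_card_powerClass_sq_le (K := K) (p := p) hL (by omega : 0 < t) htp
  set Q := ∑ u ∈ powerLevel K t 2, (powerClass t u).card ^ 2
  have hVr := card_unitPairs_le_rpow (K := K) (p := p) hT hTp
  have hN6 : N ^ 6 ≤ 4 * ((unitPairs K T).card * (t ^ 2 * Q)) := by
    calc N ^ 6 = (N ^ 3) ^ 2 := by ring
      _ ≤ (2 * (distinctTriples A).card) ^ 2 := Nat.pow_le_pow_left hc2 2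
      _ = 4 * (distinctTriples A).card ^ 2 := by ring
      _ ≤ _ := Nat.mul_le_mul_left _ hsq
  clear_value Q
  generalize (unitPairs K T).card = v at hVr hN6
  calc (N : ℝ) ^ 6 ≤ 4 * (v * ((t : ℝ) ^ 2 * Q)) := by exact_mod_cast hN6
    _ ≤ 4 * ((40 * (T : ℝ) ^ (2 / 3 : ℝ)) *
        ((t : ℝ) ^ 2 * (131072000 * L ^ 3 * t ^ 2 * Real.logb 2 t))) := by
      have h1 : (Q : ℝ) ≤ 131072000 * L ^ 3 * t ^ 2 * Real.logb 2 t :=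
        hsum.trans (mul_le_mul_of_nonneg_left hlog2 (by positivity))
      exact mul_le_mul_of_nonneg_left (mul_le_mul hVr (mul_le_mul_of_nonneg_left h1 (by positivity))
        (by positivity) (by positivity)) (by norm_num)
    _ = _ := by ring

end Triples

/-! ### Return to subgroups of `F_p^*`. -/

section Subgroups

variable {p : ℕ} [Fact p.Prime]

theorem pow_card_eq_one_of_mem {A : Subgroup (ZMod p)ˣ} {a : (ZMod p)ˣ} (ha : a ∈ A) :
    (a : ZMod p) ^ Nat.card A = 1 := by
  have h : (⟨a, ha⟩ : A) ^ Nat.card A = 1 := pow_card_eq_one'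
  have h1 : a ^ Nat.card A = 1 := congrArg Subtype.val h
  rw [← Units.val_pow_eq_pow_val, h1, Units.val_one]

/-- All nonzero differences have the same `|Γ|`-th power, so their quotients are `|Γ|`-th roots of
unity whatever `ξ` is. -/
theorem sub_pow_card_eq {Γ : Subgroup (ZMod p)ˣ} {ξ : (ZMod p)ˣ} {S : Set (ZMod p)}
    (hS : S - S ⊆ cosetWithZero ξ Γ) {x y : ZMod p} (hx : x ∈ S) (hy : y ∈ S) (hxy : x ≠ y) :
    (x - y) ^ Nat.card Γ = (ξ : ZMod p) ^ Nat.card Γ := by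
  rcases hS (Set.sub_mem_sub hx hy) with ⟨γ, hγ, h⟩ | h
  · rw [h, mul_pow, pow_card_eq_one_of_mem hγ, mul_one]
  · exact absurd (sub_eq_zero.1 h) hxy

theorem tripleRatio_mem_unitPairs {Γ : Subgroup (ZMod p)ˣ} {ξ : (ZMod p)ˣ} {A : Finset (ZMod p)}
    (hA : (A : Set (ZMod p)) - (A : Set (ZMod p)) ⊆ cosetWithZero ξ Γ) :
    ∀ q ∈ distinctTriples A, tripleRatio q ∈ unitPairs (ZMod p) (Nat.card Γ) := by
  rintro ⟨a, b, c⟩ hq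
  obtain ⟨⟨ha, hb, hc⟩, hab, hac, hbc⟩ := mem_distinctTriples.1 hq
  have hξ : (ξ : ZMod p) ^ Nat.card Γ ≠ 0 := pow_ne_zero _ ξ.ne_zero
  have h1 : 1 - (a - b) / (a - c) = (b - c) / (a - c) := by
    have := sub_ne_zero.2 hac
    field_simp
    ring
  simp only [unitPairs, Finset.mem_filter, Finset.mem_univ, true_and, tripleRatio]
  rw [h1, div_pow, div_pow, sub_pow_card_eq hA ha hb hab, sub_pow_card_eq hA ha hc hac,
    sub_pow_card_eq hA hb hc hbc, div_self hξ]
  exact ⟨rfl, rfl⟩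

theorem pow_four_le_pow_three {T p : ℕ} (h : (T : ℝ) < (p : ℝ) ^ (3 / 4 : ℝ)) :
    T ^ 4 ≤ p ^ 3 := by
  have h1 : (T : ℝ) ^ 4 ≤ ((p : ℝ) ^ (3 / 4 : ℝ)) ^ 4 := pow_le_pow_left₀ (by positivity) h.le 4
  have h2 : ((p : ℝ) ^ (3 / 4 : ℝ)) ^ 4 = (p : ℝ) ^ 3 := by
    rw [← Real.rpow_natCast, ← Real.rpow_mul (by positivity), ← Real.rpow_natCast]
    norm_num
  rw [h2] at h1
  exact_mod_cast h1

theorem card_pow_six_le_of_subset_shift {A Γ : Subgroup (ZMod p)ˣ} {s : ZMod p} {ξ : (ZMod p)ˣ}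
    {A' : Finset (ZMod p)} {L : ℕ} (hL : 0 < L) (hA2 : 2 ≤ Nat.card A)
    (hAp : Nat.card A ^ 2 ≤ L * p) (hΓ : (Nat.card Γ : ℝ) < (p : ℝ) ^ (3 / 4 : ℝ))
    (hA' : (A' : Set (ZMod p)) ⊆ subgroupShift A s)
    (hdiff : (A' : Set (ZMod p)) - (A' : Set (ZMod p)) ⊆ cosetWithZero ξ Γ) :
    (A'.card : ℝ) ^ 6 ≤ 20971520000 * L ^ 3 * ((Nat.card A : ℝ) ^ 4 *
      (Nat.card Γ : ℝ) ^ (2 / 3 : ℝ) * Real.logb 2 (Nat.card A)) := by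
  have hcard : (A'.image fun x => x - s).card = A'.card :=
    Finset.card_image_of_injective _ sub_left_injective
  rw [← hcard]
  refine card_pow_six_le (p := p) hL hA2 hAp Nat.card_pos (pow_four_le_pow_three hΓ) ?_
    (tripleRatio_mem_unitPairs (ξ := ξ) ?_)
  · intro x hx
    obtain ⟨y, hy, rfl⟩ := Finset.mem_image.1 hx
    obtain ⟨a, ha, rfl⟩ := hA' hy
    rw [add_sub_cancel_right]
    exact pow_card_eq_one_of_mem ha
  · rintro _ ⟨x, hx, y, hy, rfl⟩
    obtain ⟨x, hx', rfl⟩ := Finset.mem_image.1 (Finset.mem_coe.1 hx)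
    obtain ⟨y, hy', rfl⟩ := Finset.mem_image.1 (Finset.mem_coe.1 hy)
    refine hdiff ⟨x, hx', y, hy', ?_⟩
    simp

theorem exists_finset_eq_subgroupSet (A : Subgroup (ZMod p)ˣ) :
    ∃ S : Finset (ZMod p), (S : Set (ZMod p)) = subgroupSet A ∧ S.card = Nat.card A := by
  refine ⟨(subgroupSet A).toFinite.toFinset, by simp, ?_⟩
  rw [← Set.ncard_eq_toFinset_card, ← Nat.card_coe_set_eq]
  refine (Nat.card_congr (Equiv.ofBijective (fun a : A => (⟨(a.1 : ZMod p), a.1, a.2, rfl⟩ :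
    subgroupSet A)) ⟨fun a b h => ?_, ?_⟩)).symm
  · exact Subtype.ext (Units.ext (congrArg Subtype.val h))
  · rintro ⟨_, a, ha, rfl⟩
    exact ⟨⟨a, ha⟩, rfl⟩

theorem card_le_card_unitPairs_add_two {A Γ : Subgroup (ZMod p)ˣ} {ξ : (ZMod p)ˣ}
    (hdiff : subgroupSet A - subgroupSet A ⊆ cosetWithZero ξ Γ) :
    Nat.card A ≤ (unitPairs (ZMod p) (Nat.card Γ)).card + 2 := by
  obtain ⟨S, hS, hcard⟩ := exists_finset_eq_subgroupSet A
  rw [← hcard]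
  refine card_le_card_add_two (tripleRatio_mem_unitPairs (ξ := ξ) ?_)
  rwa [hS]

/-- `|V| ≤ 40 T^{2/3}` and `T < p^{3/4}` give `|V|² ≤ 1600p`. Then `(|V|+2)² ≤ 2|V|² + 8 ≤ 3300p`.
-/
theorem card_sq_le_of_sub_subset {A Γ : Subgroup (ZMod p)ˣ} {ξ : (ZMod p)ˣ}
    (hΓ : (Nat.card Γ : ℝ) < (p : ℝ) ^ (3 / 4 : ℝ))
    (hdiff : subgroupSet A - subgroupSet A ⊆ cosetWithZero ξ Γ) :
    Nat.card A ^ 2 ≤ 3300 * p := by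
  have hTp := pow_four_le_pow_three hΓ
  have h1 := card_unitPairs_pow_three_le (K := ZMod p) (p := p) (Nat.card_pos (α := Γ)) hTp
  have h2 := card_le_card_unitPairs_add_two hdiff
  set V := (unitPairs (ZMod p) (Nat.card Γ)).card
  set T := Nat.card Γ
  have h3 : V ^ 2 ≤ 1600 * p := by
    refine (Nat.pow_le_pow_iff_left (n := 6) (by norm_num)).1 ?_
    calc (V ^ 2) ^ 6 = (V ^ 3) ^ 4 := by ring
      _ ≤ (64000 * T ^ 2) ^ 4 := Nat.pow_le_pow_left h1 4
      _ = 64000 ^ 4 * (T ^ 4) ^ 2 := by ring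
      _ ≤ 64000 ^ 4 * (p ^ 3) ^ 2 := Nat.mul_le_mul_left _ (Nat.pow_le_pow_left hTp 2)
      _ = (1600 * p) ^ 6 := by ring
  have hp : 2 ≤ p := (Fact.out : p.Prime).two_le
  have h4 := Nat.pow_le_pow_left h2 2
  zify at *
  nlinarith [sq_nonneg ((V : ℤ) - 2)]

theorem card_le_rpow_mul_logb {A Γ : Subgroup (ZMod p)ˣ} {ξ : (ZMod p)ˣ} (hΓ2 : 2 ≤ Nat.card Γ)
    (hΓ : (Nat.card Γ : ℝ) < (p : ℝ) ^ (3 / 4 : ℝ))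
    (hdiff : subgroupSet A - subgroupSet A ⊆ cosetWithZero ξ Γ) :
    (Nat.card A : ℝ) ≤ 10 ^ 11 * ((Nat.card Γ : ℝ) ^ (1 / 3 : ℝ) *
      (Real.logb 2 (Nat.card Γ)) ^ (1 / 2 : ℝ)) := by
  have hAp := card_sq_le_of_sub_subset hΓ hdiff
  have hAV := (card_le_card_unitPairs_add_two hdiff).trans
    (Nat.add_le_add_right (card_unitPairs_le (K := ZMod p) (Nat.card_pos (α := Γ))) 2)
  obtain ⟨S, hS, hcard⟩ := exists_finset_eq_subgroupSet A
  have hlog := one_le_logb_two hΓ2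
  set T := Nat.card Γ with hT
  set t := Nat.card A with ht
  have hT2 : (2 : ℝ) ≤ T := by exact_mod_cast hΓ2
  have hTr : 1 ≤ (T : ℝ) ^ (1 / 3 : ℝ) := Real.one_le_rpow (by linarith) (by norm_num)
  have hlr : 1 ≤ (Real.logb 2 T) ^ (1 / 2 : ℝ) := Real.one_le_rpow hlog (by norm_num)
  rcases lt_or_ge t 2 with h2 | h2
  · have h3 : (t : ℝ) ≤ 1 := by exact_mod_cast (by omega : t ≤ 1)
    have := one_le_mul_of_one_le_of_one_le hTr hlr
    linarith
  have h6 := card_pow_six_le_of_subset_shift (s := 0) (A' := S) (ξ := ξ) (by norm_num : 0 < 3300)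
    h2 hAp hΓ (by rw [hS]; rintro _ ⟨a, ha, rfl⟩; exact ⟨a, ha, by simp⟩) (by rwa [hS])
  rw [hcard, ← hT, ← ht] at h6
  have ht2 : (2 : ℝ) ≤ t := by exact_mod_cast h2
  -- `t ≤ T + 2 ≤ T²` trades `log t` for `2 log T`.
  have htT : Real.logb 2 t ≤ 2 * Real.logb 2 T := by
    have h3 : (t : ℝ) ≤ (T : ℝ) ^ 2 := by
      have : t ≤ T ^ 2 := by nlinarith
      exact_mod_cast this
    have h4 := Real.logb_le_logb_of_le one_lt_two (by linarith) h3
    rwa [Real.logb_pow, Nat.cast_ofNat] at h4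
  have hsqT : (T : ℝ) ^ (2 / 3 : ℝ) = ((T : ℝ) ^ (1 / 3 : ℝ)) ^ 2 := by
    rw [← Real.rpow_natCast, ← Real.rpow_mul (by positivity)]; norm_num
  have hsql : Real.logb 2 T = ((Real.logb 2 T) ^ (1 / 2 : ℝ)) ^ 2 := by
    rw [← Real.rpow_natCast, ← Real.rpow_mul (by linarith)]; norm_num
  have h7 : (t : ℝ) ^ 2 ≤ 20971520000 * 3300 ^ 3 *
      ((T : ℝ) ^ (2 / 3 : ℝ) * (2 * Real.logb 2 T)) := by
    refine le_of_mul_le_mul_left ?_ (show (0 : ℝ) < (t : ℝ) ^ 4 by positivity)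
    calc (t : ℝ) ^ 4 * (t : ℝ) ^ 2 = (t : ℝ) ^ 6 := by ring
      _ ≤ 20971520000 * (3300 : ℕ) ^ 3 * ((t : ℝ) ^ 4 * (T : ℝ) ^ (2 / 3 : ℝ) * Real.logb 2 t) := h6
      _ ≤ 20971520000 * (3300 : ℕ) ^ 3 *
          ((t : ℝ) ^ 4 * (T : ℝ) ^ (2 / 3 : ℝ) * (2 * Real.logb 2 T)) :=
        mul_le_mul_of_nonneg_left (mul_le_mul_of_nonneg_left htT (by positivity)) (by positivity)
      _ = _ := by push_cast; ring
  rw [hsqT] at h7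
  refine le_of_pow_le_pow_left₀ two_ne_zero (by positivity) (h7.trans ?_)
  rw [mul_pow, mul_pow, ← hsql]
  have h8 : 0 ≤ ((T : ℝ) ^ (1 / 3 : ℝ)) ^ 2 * Real.logb 2 T := by positivity
  linarith

/-- Square root of `log x ≤ x^δ/δ` with `δ = 2ε`. -/
theorem logb_rpow_half_le {ε x : ℝ} (hε : 0 < ε) (hx : 1 ≤ x) :
    (Real.logb 2 x) ^ (1 / 2 : ℝ) ≤ (1 / (2 * ε * Real.log 2)) ^ (1 / 2 : ℝ) * x ^ ε := by
  have hl2 : 0 < Real.log 2 := Real.log_pos one_lt_two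
  have h1 : Real.logb 2 x ≤ 1 / (2 * ε * Real.log 2) * x ^ (2 * ε) := by
    have h2 := Real.log_le_rpow_div (by linarith : 0 ≤ x) (by positivity : 0 < 2 * ε)
    rw [Real.logb, div_le_iff₀ hl2]
    refine h2.trans (le_of_eq ?_)
    field_simp
  refine (Real.rpow_le_rpow (Real.logb_nonneg one_lt_two hx) h1 (by norm_num)).trans
    (le_of_eq ?_)
  rw [Real.mul_rpow (by positivity) (by positivity), ← Real.rpow_mul (by linarith)]
  congr 2
  ring

end Subgroups

theorem theoremt :
    (∃ C : ℝ, 0 < C ∧ ∀ (p : ℕ) [Fact p.Prime] (A Γ : Subgroup (ZMod p)ˣ)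
      (s : ZMod p) (ξ : (ZMod p)ˣ) (A' : Finset (ZMod p)),
      2 ≤ Nat.card A →
      (Nat.card A : ℝ) < Real.sqrt p →
      (Nat.card Γ : ℝ) < (p : ℝ) ^ (3 / 4 : ℝ) →
      (A' : Set (ZMod p)) ⊆ subgroupShift A s →
      (A' : Set (ZMod p)) - (A' : Set (ZMod p)) ⊆ cosetWithZero ξ Γ →
      (A'.card : ℝ) ^ 6 ≤
        C * ((Nat.card A : ℝ) ^ 4 * (Nat.card Γ : ℝ) ^ (2 / 3 : ℝ) *
          Real.logb 2 (Nat.card A))) ∧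
    (∃ C : ℝ, 0 < C ∧ ∀ (p : ℕ) [Fact p.Prime] (A Γ : Subgroup (ZMod p)ˣ) (ξ : (ZMod p)ˣ),
      2 ≤ Nat.card Γ →
      (Nat.card Γ : ℝ) < (p : ℝ) ^ (3 / 4 : ℝ) →
      subgroupSet A - subgroupSet A ⊆ cosetWithZero ξ Γ →
      (Nat.card A : ℝ) ≤
        C * ((Nat.card Γ : ℝ) ^ (1 / 3 : ℝ) *
          (Real.logb 2 (Nat.card Γ)) ^ (1 / 2 : ℝ))) ∧
    (∀ ε : ℝ, 0 < ε → ∃ C : ℝ, 0 < C ∧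
      ∀ (p : ℕ) [Fact p.Prime] (A Γ : Subgroup (ZMod p)ˣ) (ξ : (ZMod p)ˣ),
      (Nat.card Γ : ℝ) < (p : ℝ) ^ (3 / 4 : ℝ) →
      subgroupSet A - subgroupSet A ⊆ cosetWithZero ξ Γ →
      (Nat.card A : ℝ) ≤ C * (Nat.card Γ : ℝ) ^ (1 / 3 + ε)) := by
  refine ⟨⟨20971520000 * (1 : ℕ) ^ 3, by norm_num, ?_⟩, ⟨10 ^ 11, by norm_num, ?_⟩, ?_⟩
  · intro p _ A Γ s ξ A' hA2 hAp hΓ hA' hdiff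
    refine card_pow_six_le_of_subset_shift one_pos hA2 ?_ hΓ hA' hdiff
    rw [Real.lt_sqrt (by positivity)] at hAp
    rw [one_mul]
    exact_mod_cast hAp.le
  · intro p _ A Γ ξ hΓ2 hΓ hdiff
    exact card_le_rpow_mul_logb hΓ2 hΓ hdiff
  · intro ε hε
    have hl2 : 0 < Real.log 2 := Real.log_pos one_lt_two
    -- The summand `3` covers trivial `Γ`, where the logarithm vanishes and `|A| ≤ |V| + 2 ≤ 3`.
    refine ⟨3 + 10 ^ 11 * (1 / (2 * ε * Real.log 2)) ^ (1 / 2 : ℝ), by positivity, ?_⟩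
    intro p _ A Γ ξ hΓ hdiff
    have hT1 : (1 : ℝ) ≤ Nat.card Γ := by exact_mod_cast Nat.card_pos (α := Γ)
    have hTr : 1 ≤ (Nat.card Γ : ℝ) ^ (1 / 3 + ε) := Real.one_le_rpow hT1 (by positivity)
    have hc : 0 ≤ 10 ^ 11 * (1 / (2 * ε * Real.log 2)) ^ (1 / 2 : ℝ) := by positivity
    rcases lt_or_ge (Nat.card Γ) 2 with h2 | h2
    · have hA3 : Nat.card A ≤ 3 := by
        have h3 := card_le_card_unitPairs_add_two hdiff
        have h4 := card_unitPairs_le (K := ZMod p) (Nat.card_pos (α := Γ))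
        omega
      have hA3' : (Nat.card A : ℝ) ≤ 3 := by exact_mod_cast hA3
      nlinarith
    · refine (card_le_rpow_mul_logb h2 hΓ hdiff).trans ?_
      have h3 := logb_rpow_half_le hε hT1
      calc 10 ^ 11 * ((Nat.card Γ : ℝ) ^ (1 / 3 : ℝ) *
            (Real.logb 2 (Nat.card Γ)) ^ (1 / 2 : ℝ))
          ≤ 10 ^ 11 * ((Nat.card Γ : ℝ) ^ (1 / 3 : ℝ) *
            ((1 / (2 * ε * Real.log 2)) ^ (1 / 2 : ℝ) * (Nat.card Γ : ℝ) ^ ε)) := by gcongr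
        _ = 10 ^ 11 * (1 / (2 * ε * Real.log 2)) ^ (1 / 2 : ℝ) *
            (Nat.card Γ : ℝ) ^ (1 / 3 + ε) := by
          rw [Real.rpow_add (by linarith)]; ring
        _ ≤ _ := by
          refine mul_le_mul_of_nonneg_right ?_ (by positivity)
          linarith
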